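/- Let $D=(V,A)$ be a finite directed multigraph with a source node $s\in V$, in which every arc has unit capacity. For $v\ne s$ let $\lambda(v)$ be the value of a maximum flow from $s$ to $v$, and for $U\subseteq V$ let $\rho(U)$ be the number of arcs with tail outside $U$ and head in $U$. Suppose that $D$ is link-minimal: for every arc $e$, deleting $e$ decreases $\lambda(v)$ for some node $v\neq s$. Let $(H,(B_x)_{x\in X})$ be a tree decomposition of width at most $2$ of the underlying undirected simple graph of $D$; that is, $H$ is a finite tree with node set $X$, each $B_x$ is a subset of $V$ with $|B_x|\le 3$, every node of $D$ lies in some bag, the two ends of every edge lie in a common bag, and $B_x\cap B_y\subseteq B_z$ whenever $z$ lies on the path of $H$ between $x$ and $y$. Then there is a finite family of pairwise arc-disjoint directed trees in $D$, each containing $s$ and oriented away from $s$ (not necessarily spanning $V$), such that 1. every node $v\neq s$ lies in exactly $\lambda(v)$ of the trees; 2. for any two nodes $u,v\ne s$ that lie in a common bag $B_x$, at least $$\eta(u,v)=\min\{\rho(U) : U\subseteq V,\ u,v\in U,\ s\notin U\}$$ of the trees contain $u$ or $v$. -/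

import Mathlib

/-- A network: a directed multigraph with node type `V` and link type `A`, and a source node.
Every link has unit capacity; parallel links are distinct elements of `A`. -/
structure Network (V A : Type*) where
  tail : A → V
  head : A → V
  source : V

namespace Network

variable {V A : Type*}

/-- The network with the link `e` removed. -/
def deleteLink (D : Network V A) (e : A) : Network V {a : A // a ≠ e} where
  tail a := D.tail a
  head a := D.head a
  source := D.source

/-- The topology of a network: its underlying undirected simple graph. -/
def topology (D : Network V A) : SimpleGraph V :=
  SimpleGraph.fromRel fun u v => ∃ a, D.tail a = u ∧ D.head a = v

/-- Total amount entering `v` minus total amount leaving `v`. -/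
def netIn [DecidableEq V] [Fintype A] (D : Network V A) (f : A → ℝ) (v : V) : ℝ :=
  (∑ a with D.head a = v, f a) - ∑ a with D.tail a = v, f a

/-- `f` is a flow from the source to `t` under unit link capacities. -/
structure IsFlow [DecidableEq V] [Fintype A] (D : Network V A) (t : V) (f : A → ℝ) : Prop where
  nonneg : ∀ a, 0 ≤ f a
  le_capacity : ∀ a, f a ≤ 1
  conservation : ∀ v, v ≠ D.source → v ≠ t → D.netIn f v = 0

/-- `λ(t)`: the value of a maximum flow from the source to `t`. -/
noncomputable def maxFlow [DecidableEq V] [Fintype A] (D : Network V A) (t : V) : ℝ :=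
  sSup {x | ∃ f, D.IsFlow t f ∧ D.netIn f t = x}

theorem maxFlow_set_nonempty [DecidableEq V] [Fintype A] (D : Network V A) (t : V) :
    {x | ∃ f, D.IsFlow t f ∧ D.netIn f t = x}.Nonempty :=
  ⟨0, fun _ => 0, ⟨fun _ => le_rfl, fun _ => zero_le_one, fun v _ _ => by simp [netIn]⟩,
    by simp [netIn]⟩

theorem maxFlow_set_bddAbove [DecidableEq V] [Fintype A] (D : Network V A) (t : V) :
    BddAbove {x | ∃ f, D.IsFlow t f ∧ D.netIn f t = x} := by
  refine ⟨((Finset.univ.filter fun a => D.head a = t).card : ℝ), ?_⟩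
  rintro x ⟨f, hf, rfl⟩
  have h1 : (∑ a with D.head a = t, f a) ≤ ∑ a with D.head a = t, (1 : ℝ) :=
    Finset.sum_le_sum fun a _ => hf.le_capacity a
  have h2 : 0 ≤ ∑ a with D.tail a = t, f a := Finset.sum_nonneg fun a _ => hf.nonneg a
  simp only [Finset.sum_const, nsmul_eq_mul, mul_one] at h1
  unfold netIn
  linarith

/-- A network is link-minimal if removing any link decreases the max-flow to some
non-source node. -/
def IsLinkMinimal [DecidableEq V] [DecidableEq A] [Fintype A] (D : Network V A) : Prop :=
  ∀ e : A, ∃ v, v ≠ D.source ∧ (D.deleteLink e).maxFlow v < D.maxFlow v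

/-- `ρ(U)`: the number of links entering `U` from its complement. -/
def inCut [DecidableEq V] [Fintype A] (D : Network V A) (U : Finset V) : ℕ :=
  (Finset.univ.filter fun a => D.tail a ∉ U ∧ D.head a ∈ U).card

/-- `η(u,v)`: the minimum of `ρ(U)` over all `U` that contain `u` and `v` but not the source
(for `u`, `v` distinct from the source such sets exist, so the minimum is attained). -/
noncomputable def pairCut [DecidableEq V] [Fintype A] (D : Network V A) (u v : V) : ℕ :=
  sInf {n | ∃ U : Finset V, u ∈ U ∧ v ∈ U ∧ D.source ∉ U ∧ D.inCut U = n}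

/-- `W` and `F` are the node set and link set of a directed tree in `D` rooted at the source and
oriented away from it. -/
structure IsSourceTree (D : Network V A) (W : Finset V) (F : Finset A) : Prop where
  source_mem : D.source ∈ W
  tail_mem : ∀ a ∈ F, D.tail a ∈ W
  head_mem : ∀ a ∈ F, D.head a ∈ W
  source_ne_head : ∀ a ∈ F, D.head a ≠ D.source
  existsUnique_link : ∀ v ∈ W, v ≠ D.source → ∃! a, a ∈ F ∧ D.head a = v
  reachable : ∀ v ∈ W,
    Relation.ReflTransGen (fun x y => ∃ a ∈ F, D.tail a = x ∧ D.head a = y) D.source v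

/-- A tree packing: a finite family of pairwise link-disjoint trees rooted at the source. -/
structure TreePacking (D : Network V A) where
  size : ℕ
  nodes : Fin size → Finset V
  links : Fin size → Finset A
  isSourceTree : ∀ i, D.IsSourceTree (nodes i) (links i)
  disjoint : ∀ i j, i ≠ j → Disjoint (links i) (links j)

end Network

/-- A tree decomposition of `G`: a tree on the finite index type `X` together with a bag of
vertices for each tree node. -/
structure TreeDecomposition {V : Type*} (G : SimpleGraph V) (X : Type*) where
  tree : SimpleGraph X
  isTree : tree.IsTree
  bag : X → Finset V
  vertex_mem : ∀ v, ∃ x, v ∈ bag x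
  edge_mem : ∀ u v, G.Adj u v → ∃ x, u ∈ bag x ∧ v ∈ bag x
  path_mem : ∀ (x y z : X) (p : tree.Walk x y), p.IsPath → z ∈ p.support →
    ∀ v, v ∈ bag x → v ∈ bag y → v ∈ bag z

/-- The width of a tree decomposition: the largest size of a bag, minus one. -/
def TreeDecomposition.width {V X : Type*} [Fintype X] {G : SimpleGraph V}
    (T : TreeDecomposition G X) : ℤ :=
  ((Finset.univ.sup fun x => (T.bag x).card : ℕ) : ℤ) - 1

/-! Link-minimality forces every node other than s to have in-degree λ
(`IsLinkMinimal.inCut_singleton_le`, by uncrossing minimum cuts). So condition 1 holds once the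
trees use up all links, loops and links into s aside, and only the multiplicities of parallel links
matter.

The packing is built by eliminating vertices. Treewidth two yields a vertex w whose only neighbours
u, v share a bag (`TreeDecomposition.exists_elimination`). Let a, b count the links u→w, v→w, and c,
d the links w→u, w→v. Since in-degrees are at most cuts, comparing {u} with {w,u} gives c ≤ b, and
likewise d ≤ a. So w can be deleted in favour of d links u→v and c links v→u. The other in-degrees
are unchanged and every new cut equals an old one, so the induction applies.

Conversely, w is inserted below u in a trees and below v in b other trees, among them the trees that
used the new links, which are rerouted through w (`IsRouting.exists_extension`). There is room
because condition 2 for u, v gives at least a + b trees meeting {u,v}; hence condition 2 is carried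
through the induction. Preferring trees that contain just one of u, v (`exists_tree_choice`)
restores condition 2 for the pairs w, u and w, v. -/

namespace Network

variable {V A : Type*}

/-! ### Max-flow min-cut for real-valued flows. -/

section Flow

variable [DecidableEq V] [Fintype A] (D : Network V A)

theorem netIn_add (f g : A → ℝ) (v : V) :
    D.netIn (fun a => f a + g a) v = D.netIn f v + D.netIn g v := by
  simp only [netIn, Finset.sum_add_distrib]
  ring

theorem netIn_mul (ε : ℝ) (f : A → ℝ) (v : V) :
    D.netIn (fun a => ε * f a) v = ε * D.netIn f v := by
  simp only [netIn, ← Finset.mul_sum]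
  ring

theorem netIn_single [DecidableEq A] (a : A) (r : ℝ) (v : V) :
    D.netIn (fun b => if b = a then r else 0) v =
      (if D.head a = v then r else 0) - (if D.tail a = v then r else 0) := by
  simp [netIn, Finset.sum_ite_eq']

/-- Links with both ends in `U` cancel. -/
theorem sum_netIn (f : A → ℝ) (U : Finset V) :
    ∑ v ∈ U, D.netIn f v = (∑ a with D.tail a ∉ U ∧ D.head a ∈ U, f a)
      - ∑ a with D.tail a ∈ U ∧ D.head a ∉ U, f a := by
  simp only [netIn, Finset.sum_sub_distrib, Finset.sum_filter]
  rw [Finset.sum_comm, Finset.sum_comm (s := U), ← Finset.sum_sub_distrib,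
    ← Finset.sum_sub_distrib]
  refine Finset.sum_congr rfl fun a _ => ?_
  simp only [Finset.sum_ite_eq]
  by_cases h1 : D.head a ∈ U <;> by_cases h2 : D.tail a ∈ U <;> simp [h1, h2]

theorem sum_netIn_eq_of_isFlow {f : A → ℝ} {t : V} (hf : D.IsFlow t f) {U : Finset V}
    (ht : t ∈ U) (hs : D.source ∉ U) : ∑ v ∈ U, D.netIn f v = D.netIn f t :=
  Finset.sum_eq_single_of_mem t ht fun v hv hvt =>
    hf.conservation v (fun h => hs (h ▸ hv)) hvt

theorem maxFlow_le_inCut {t : V} {U : Finset V} (ht : t ∈ U) (hs : D.source ∉ U) :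
    D.maxFlow t ≤ D.inCut U := by
  refine csSup_le (D.maxFlow_set_nonempty t) ?_
  rintro x ⟨f, hf, rfl⟩
  rw [← D.sum_netIn_eq_of_isFlow hf ht hs, sum_netIn]
  have h1 : (∑ a with D.tail a ∉ U ∧ D.head a ∈ U, f a)
      ≤ ∑ a with D.tail a ∉ U ∧ D.head a ∈ U, (1 : ℝ) :=
    Finset.sum_le_sum fun a _ => hf.le_capacity a
  have h2 : 0 ≤ ∑ a with D.tail a ∈ U ∧ D.head a ∉ U, f a :=
    Finset.sum_nonneg fun a _ => hf.nonneg a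
  simp only [Finset.sum_const, nsmul_eq_mul, mul_one] at h1
  unfold inCut
  linarith

/-- The flows form a closed subset of the unit cube, so the supremum is attained by compactness. -/
theorem exists_isFlow_netIn_eq_maxFlow (t : V) :
    ∃ f, D.IsFlow t f ∧ D.netIn f t = D.maxFlow t := by
  have hcont : ∀ v, Continuous fun f : A → ℝ => D.netIn f v := fun v => by
    unfold netIn
    fun_prop
  have hset : {f | D.IsFlow t f} =
      Set.Icc (0 : A → ℝ) 1 ∩ ⋂ v, ⋂ (_ : v ≠ D.source ∧ v ≠ t), {f | D.netIn f v = 0} := by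
    ext f
    simp only [Set.mem_ofPred_eq, Set.mem_inter_iff, Set.mem_Icc, Set.mem_iInter]
    exact ⟨fun h => ⟨⟨h.nonneg, h.le_capacity⟩, fun v hv => h.conservation v hv.1 hv.2⟩,
      fun h => ⟨h.1.1, h.1.2, fun v h1 h2 => h.2 v ⟨h1, h2⟩⟩⟩
  have hcompact : IsCompact {f | D.IsFlow t f} := by
    rw [hset]
    exact isCompact_Icc.inter_right (isClosed_iInter fun v => isClosed_iInter fun _ =>
      isClosed_eq (hcont v) continuous_const)
  have hne : {x | ∃ f, D.IsFlow t f ∧ D.netIn f t = x} =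
      (fun f => D.netIn f t) '' {f | D.IsFlow t f} := rfl
  have := (hcompact.image (hcont t)).sSup_mem (by
    rw [← hne]
    exact D.maxFlow_set_nonempty t)
  exact this

/-- One step in the residual network of `f`. -/
def ResidualStep (f : A → ℝ) (x y : V) : Prop :=
  ∃ a, (f a < 1 ∧ D.tail a = x ∧ D.head a = y) ∨ (0 < f a ∧ D.head a = x ∧ D.tail a = y)

/-- `g` is the signed sum of the links on a residual walk. The walk may repeat links, so `g` serves
only as a direction, with the right sign wherever `f` is at a bound. -/
theorem exists_direction [DecidableEq A] {f : A → ℝ} {x : V}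
    (h : Relation.ReflTransGen (D.ResidualStep f) D.source x) :
    ∃ g : A → ℝ, (∀ a, f a ≤ 0 → 0 ≤ g a) ∧ (∀ a, 1 ≤ f a → g a ≤ 0) ∧
      ∀ v, D.netIn g v = (if x = v then 1 else 0) - (if D.source = v then 1 else 0) := by
  induction h with
  | refl => exact ⟨fun _ => 0, fun _ _ => le_rfl, fun _ _ => le_rfl, fun v => by simp [netIn]⟩
  | tail _ hstep ih =>
    obtain ⟨g, h0, h1, hg⟩ := ih
    obtain ⟨a, ⟨ha, rfl, rfl⟩ | ⟨ha, rfl, rfl⟩⟩ := hstep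
    · refine ⟨fun b => g b + if b = a then 1 else 0, fun b hb => ?_, fun b hb => ?_, fun v => ?_⟩
      · have := h0 b hb
        dsimp only
        split_ifs <;> linarith
      · have := h1 b hb
        have hba : b ≠ a := by
          rintro rfl
          linarith
        simpa [hba] using this
      · rw [netIn_add, netIn_single, hg]
        ring
    · refine ⟨fun b => g b + if b = a then -1 else 0, fun b hb => ?_, fun b hb => ?_, fun v => ?_⟩
      · have := h0 b hb
        have hba : b ≠ a := by
          rintro rfl
          linarith
        simpa [hba] using this
      · have := h1 b hb
        dsimp only
        split_ifs <;> linarith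
      · rw [netIn_add, netIn_single, hg]
        split_ifs <;> ring

theorem exists_pos_mul_add_mem_Icc {x g : ℝ} (h0 : 0 ≤ x) (h1 : x ≤ 1) (hg0 : x ≤ 0 → 0 ≤ g)
    (hg1 : 1 ≤ x → g ≤ 0) :
    ∃ δ > 0, ∀ ε, 0 < ε → ε ≤ δ → 0 ≤ x + ε * g ∧ x + ε * g ≤ 1 := by
  have lower : ∃ δ > 0, ∀ ε, 0 < ε → ε ≤ δ → 0 ≤ x + ε * g := by
    rcases h0.eq_or_lt with h | h
    · exact ⟨1, one_pos, fun ε hε _ => by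
        have := mul_nonneg hε.le (hg0 h.ge)
        linarith⟩
    · refine ⟨x / (|g| + 1), by positivity, fun ε hε hle => ?_⟩
      rw [le_div_iff₀ (by positivity)] at hle
      nlinarith [neg_abs_le g]
  have upper : ∃ δ > 0, ∀ ε, 0 < ε → ε ≤ δ → x + ε * g ≤ 1 := by
    rcases h1.eq_or_lt with h | h
    · exact ⟨1, one_pos, fun ε hε _ => by
        have := mul_nonneg hε.le (neg_nonneg.2 (hg1 h.ge))
        linarith⟩
    · have h' : 0 < 1 - x := by linarith
      refine ⟨(1 - x) / (|g| + 1), by positivity, fun ε hε hle => ?_⟩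
      rw [le_div_iff₀ (by positivity)] at hle
      nlinarith [le_abs_self g]
  obtain ⟨δ, hδ, h⟩ := lower
  obtain ⟨δ', hδ', h'⟩ := upper
  exact ⟨min δ δ', lt_min hδ hδ', fun ε hε hle =>
    ⟨h ε hε (hle.trans (min_le_left _ _)), h' ε hε (hle.trans (min_le_right _ _))⟩⟩

/-- The max-flow min-cut theorem. -/
theorem exists_inCut_eq_maxFlow [Fintype V] [DecidableEq A] {t : V} (ht : t ≠ D.source) :
    ∃ U : Finset V, t ∈ U ∧ D.source ∉ U ∧ (D.inCut U : ℝ) = D.maxFlow t := by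
  classical
  obtain ⟨f, hf, hmax⟩ := D.exists_isFlow_netIn_eq_maxFlow t
  by_cases hreach : Relation.ReflTransGen (D.ResidualStep f) D.source t
  · exfalso
    obtain ⟨g, h0, h1, hg⟩ := exists_direction D hreach
    choose δ hδ hδ' using fun a =>
      exists_pos_mul_add_mem_Icc (hf.nonneg a) (hf.le_capacity a) (h0 a) (h1 a)
    obtain ⟨ε, hε, hle⟩ : ∃ ε > 0, ∀ a, ε ≤ δ a := by
      rcases isEmpty_or_nonempty A with h | h
      · exact ⟨1, one_pos, fun a => h.elim a⟩
      · obtain ⟨a, ha⟩ := Finite.exists_min δ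
        exact ⟨δ a, hδ a, ha⟩
    have hflow : D.IsFlow t fun a => f a + ε * g a :=
      ⟨fun a => (hδ' a ε hε (hle a)).1, fun a => (hδ' a ε hε (hle a)).2, fun v hvs hvt => by
        rw [netIn_add, netIn_mul, hf.conservation v hvs hvt, hg]
        simp [hvs.symm, hvt.symm]⟩
    have hval : D.netIn (fun a => f a + ε * g a) t = D.maxFlow t + ε := by
      rw [netIn_add, netIn_mul, hmax, hg]
      simp [ht.symm]
    have := le_csSup (D.maxFlow_set_bddAbove t) ⟨_, hflow, hval⟩
    unfold maxFlow at this
    linarith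
  -- The cut consists of the nodes not residually reachable: links entering it are saturated, links
  -- leaving it are empty.
  · have htU : t ∈ Finset.univ.filter fun v =>
        ¬ Relation.ReflTransGen (D.ResidualStep f) D.source v := by simpa using hreach
    have hsU : D.source ∉ Finset.univ.filter fun v =>
        ¬ Relation.ReflTransGen (D.ResidualStep f) D.source v := by
      simpa using Relation.ReflTransGen.refl
    refine ⟨_, htU, hsU, ?_⟩
    rw [← hmax, ← D.sum_netIn_eq_of_isFlow hf htU hsU, sum_netIn, inCut]
    have hout : ∀ a, Relation.ReflTransGen (D.ResidualStep f) D.source (D.tail a) →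
        ¬ Relation.ReflTransGen (D.ResidualStep f) D.source (D.head a) → f a = 1 := by
      intro a h1 h2
      by_contra hne
      exact h2 (h1.tail ⟨a, Or.inl ⟨lt_of_le_of_ne (hf.le_capacity a) hne, rfl, rfl⟩⟩)
    have hin : ∀ a, ¬ Relation.ReflTransGen (D.ResidualStep f) D.source (D.tail a) →
        Relation.ReflTransGen (D.ResidualStep f) D.source (D.head a) → f a = 0 := by
      intro a h1 h2
      by_contra hne
      exact h1 (h2.tail ⟨a, Or.inr ⟨lt_of_le_of_ne (hf.nonneg a) (Ne.symm hne), rfl, rfl⟩⟩)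
    simp only [Finset.mem_filter, Finset.mem_univ, true_and, not_not]
    rw [Finset.sum_eq_card_nsmul (b := (1 : ℝ)), Finset.sum_eq_zero]
    · simp
    · intro a ha
      simp only [Finset.mem_filter] at ha
      exact hin a ha.2.1 ha.2.2
    · intro a ha
      simp only [Finset.mem_filter] at ha
      exact hout a ha.2.1 ha.2.2

end Flow

/-! ### Submodularity of cuts and in-degrees in link-minimal networks. -/

section Cuts

variable [DecidableEq V] [Fintype A] (D : Network V A)

theorem inCut_inter_add_inCut_union_le (U T : Finset V) :
    D.inCut (U ∩ T) + D.inCut (U ∪ T) ≤ D.inCut U + D.inCut T := by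
  simp only [inCut, Finset.card_filter, ← Finset.sum_add_distrib, Finset.mem_inter,
    Finset.mem_union]
  refine Finset.sum_le_sum fun a _ => ?_
  by_cases h1 : D.head a ∈ U <;> by_cases h2 : D.tail a ∈ U <;> by_cases h3 : D.head a ∈ T <;>
    by_cases h4 : D.tail a ∈ T <;> simp [h1, h2, h3, h4]

theorem inCut_deleteLink_add [DecidableEq A] (e : A) (U : Finset V) :
    (D.deleteLink e).inCut U + (if D.tail e ∉ U ∧ D.head e ∈ U then 1 else 0) = D.inCut U := by
  simp only [inCut, Finset.card_filter]
  rw [← Finset.add_sum_erase Finset.univ _ (Finset.mem_univ e), add_comm]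
  congr 1
  exact (Finset.sum_subtype (p := fun a => a ≠ e) (Finset.univ.erase e) (by simp)
    fun a => if D.tail a ∉ U ∧ D.head a ∈ U then 1 else 0).symm

variable {D}

/-- In a link-minimal network every link enters a set whose cut is minimum for one of its nodes. -/
theorem IsLinkMinimal.exists_tight_set [Fintype V] [DecidableEq A] (hD : D.IsLinkMinimal) (e : A) :
    ∃ w, ∃ U : Finset V, w ∈ U ∧ D.source ∉ U ∧ D.tail e ∉ U ∧ D.head e ∈ U ∧
      ∀ T : Finset V, w ∈ T → D.source ∉ T → D.inCut U ≤ D.inCut T := by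
  obtain ⟨w, hw, hlt⟩ := hD e
  obtain ⟨U, hwU, hsU, hU⟩ := (D.deleteLink e).exists_inCut_eq_maxFlow hw
  have hsU : D.source ∉ U := hsU
  rw [← hU] at hlt
  -- `U` is a minimum cut for `w` after deleting `e`, and every cut for `w` in `D` is larger.
  -- Applied to `U` itself, this forces `e` to enter `U`; by integrality the excess of one is then
  -- optimal in `D`.
  have hlt' : ∀ T : Finset V, w ∈ T → D.source ∉ T → (D.deleteLink e).inCut U < D.inCut T :=
    fun T hwT hsT => by exact_mod_cast hlt.trans_le (D.maxFlow_le_inCut hwT hsT)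
  have hadd := D.inCut_deleteLink_add e U
  have hlU := hlt' U hwU hsU
  by_cases he : D.tail e ∉ U ∧ D.head e ∈ U
  · refine ⟨w, U, hwU, hsU, he.1, he.2, fun T hwT hsT => ?_⟩
    have := hlt' T hwT hsT
    rw [if_pos he] at hadd
    omega
  · rw [if_neg he] at hadd
    omega

/-- In a link-minimal network, the in-degree of a node is at most any cut containing it. -/
theorem IsLinkMinimal.inCut_singleton_le [Fintype V] [DecidableEq A] (hD : D.IsLinkMinimal)
    {x : V} {U : Finset V} (hx : x ∈ U) (hs : D.source ∉ U) : D.inCut {x} ≤ D.inCut U := by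
  obtain ⟨T₀, hT₀, hmin₀⟩ := Finset.exists_min_image
    (Finset.univ.filter fun T : Finset V => x ∈ T ∧ D.source ∉ T) D.inCut ⟨U, by simp [hx, hs]⟩
  -- Among the minimum cuts for `x`, `T` has the fewest nodes.
  obtain ⟨T, hT, hmin⟩ := Finset.exists_min_image
    (Finset.univ.filter fun T : Finset V => (x ∈ T ∧ D.source ∉ T) ∧ D.inCut T = D.inCut T₀)
    Finset.card ⟨T₀, by simpa using hT₀⟩
  simp only [Finset.mem_filter, Finset.mem_univ, true_and] at hT₀ hmin₀ hT hmin
  obtain ⟨⟨hxT, hsT⟩, hTT₀⟩ := hT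
  rw [← hTT₀] at hmin₀ hmin
  refine le_trans ?_ (hmin₀ U ⟨hx, hs⟩)
  by_contra hlt
  -- If no link into `x` started in `T`, all of them would enter `T`, and the in-degree would be at
  -- most the cut.
  obtain ⟨e, he, heT⟩ : ∃ e, (D.tail e ∉ ({x} : Finset V) ∧ D.head e ∈ ({x} : Finset V)) ∧
      D.tail e ∈ T := by
    by_contra hcon
    push Not at hcon
    refine hlt (Finset.card_le_card fun e he => ?_)
    simp only [Finset.mem_filter, Finset.mem_univ, true_and] at he ⊢
    exact ⟨hcon e he, by rw [Finset.mem_singleton.1 he.2]; exact hxT⟩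
  obtain ⟨w, U', hwU, hsU, htU, hhU, hU⟩ := hD.exists_tight_set e
  rw [Finset.mem_singleton.1 he.2] at hhU
  have hsub := D.inCut_inter_add_inCut_union_le U' T
  have hinter := hmin₀ (U' ∩ T) ⟨by simp [hhU, hxT], by simp [hsU]⟩
  have hunion := hmin₀ (U' ∪ T) ⟨by simp [hhU], by simp [hsU, hsT]⟩
  -- Uncrossing with the tight set `U'` makes `U' ∩ T` another minimum cut for `x`; it misses the
  -- tail of `e`, against the choice of `T`.
  have heq : D.inCut (U' ∩ T) = D.inCut T := by
    by_cases hwT : w ∈ T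
    · have := hU T hwT hsT
      omega
    · have := hU (U' ∪ T) (by simp [hwU]) (by simp [hsU, hsT])
      omega
  have hcard := hmin (U' ∩ T) ⟨⟨by simp [hhU, hxT], by simp [hsU]⟩, heq⟩
  have := Finset.eq_of_subset_of_card_le Finset.inter_subset_right hcard
  rw [← this] at heT
  exact htU (Finset.mem_inter.1 heT).1

theorem IsLinkMinimal.maxFlow_eq_inCut_singleton [Fintype V] [DecidableEq A]
    (hD : D.IsLinkMinimal) {x : V} (hx : x ≠ D.source) : D.maxFlow x = D.inCut {x} := by
  refine le_antisymm (D.maxFlow_le_inCut (by simp) (by simpa using hx.symm)) ?_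
  obtain ⟨U, hxU, hsU, hU⟩ := D.exists_inCut_eq_maxFlow hx
  rw [← hU]
  exact_mod_cast hD.inCut_singleton_le hxU hsU

end Cuts

end Network

/-! ### Elimination of a vertex in a tree decomposition of width two. -/

namespace TreeDecomposition

variable {V X : Type*} {G : SimpleGraph V}

/-- Two vertices share a bag. -/
def Share (T : TreeDecomposition G X) (u v : V) : Prop :=
  ∃ x, u ∈ T.bag x ∧ v ∈ T.bag x

theorem exists_top (T : TreeDecomposition G X) (r : X) (v : V) :
    ∃ x, v ∈ T.bag x ∧ ∀ y, v ∈ T.bag y → T.tree.dist r x ≤ T.tree.dist r y := by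
  obtain ⟨x, hx, hmin⟩ := exists_minimalFor_of_wellFoundedLT (fun x => v ∈ T.bag x)
    (fun x => T.tree.dist r x) (T.vertex_mem v)
  exact ⟨x, hx, fun y hy => (le_total _ _).elim id fun h => hmin hy h⟩

/-- The path from the root to a bag containing `v` passes through the bag of `v` closest to the
root. -/
theorem exists_isPath_append (T : TreeDecomposition G X) {r x y : X} {v : V} (hx : v ∈ T.bag x)
    (hmin : ∀ y, v ∈ T.bag y → T.tree.dist r x ≤ T.tree.dist r y) (hy : v ∈ T.bag y) :
    ∃ (p : T.tree.Walk r x) (q : T.tree.Walk x y), p.IsPath ∧ p.length = T.tree.dist r x ∧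
      q.IsPath ∧ (p.append q).IsPath := by
  classical
  obtain ⟨p, hp, hlen⟩ := T.isTree.connected.exists_path_of_dist r x
  obtain ⟨q, hq, -⟩ := T.isTree.connected.exists_path_of_dist x y
  refine ⟨p, q, hp, hlen, hq, ?_⟩
  rw [SimpleGraph.Walk.isPath_def, SimpleGraph.Walk.support_append, List.nodup_append']
  refine ⟨hp.support_nodup, hq.support_nodup.tail, fun z hzp hzq => ?_⟩
  -- A tree node other than `x` on both halves would have `v` in its bag and be closer to the root
  -- than `x`.
  have hzb := T.path_mem x y z q hq (List.mem_of_mem_tail hzq) v hx hy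
  have hzx : z ≠ x := by
    rintro rfl
    have := hq.support_nodup
    rw [← SimpleGraph.Walk.cons_tail_support] at this
    exact (List.nodup_cons.1 this).1 hzq
  have h1 := p.length_takeUntil_lt_length hzp hzx
  have h2 := SimpleGraph.dist_le (p.takeUntil z hzp)
  have h3 := hmin z hzb
  omega

/-- If the bag `x` of `w` closest to the root is at least as deep as that of `z`, and `w` and `z`
share a bag, then `z` lies in the bag `x`. -/
theorem mem_bag_of_share (T : TreeDecomposition G X) {r x x' : X} {w z : V} (hx : w ∈ T.bag x)
    (hmin : ∀ y, w ∈ T.bag y → T.tree.dist r x ≤ T.tree.dist r y) (hx' : z ∈ T.bag x')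
    (hmin' : ∀ y, z ∈ T.bag y → T.tree.dist r x' ≤ T.tree.dist r y)
    (hle : T.tree.dist r x' ≤ T.tree.dist r x) (hwz : T.Share w z) : z ∈ T.bag x := by
  classical
  obtain ⟨y, hwy, hzy⟩ := hwz
  obtain ⟨p, q, -, -, -, hpq⟩ := T.exists_isPath_append hx hmin hwy
  obtain ⟨p', q', -, hlen', hq', hpq'⟩ := T.exists_isPath_append hx' hmin' hzy
  -- Both are the unique path from `r` to `y`. So `x` lies on it before `x'`, which the depths
  -- exclude unless they coincide, or after `x'`, between two bags containing `z`.
  have heq : p.append q = p'.append q' :=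
    congrArg Subtype.val ((T.isTree.isAcyclic.subsingleton_path r y).elim ⟨_, hpq⟩ ⟨_, hpq'⟩)
  have hxs : x ∈ (p'.append q').support := by
    rw [← heq, SimpleGraph.Walk.mem_support_append_iff]
    exact Or.inl p.end_mem_support
  rw [SimpleGraph.Walk.mem_support_append_iff] at hxs
  rcases hxs with h | h
  · by_cases hxx : x = x'
    · exact hxx ▸ hx'
    · have h1 := p'.length_takeUntil_lt_length h hxx
      have h2 := SimpleGraph.dist_le (p'.takeUntil x h)
      omega
  · exact T.path_mem x' y x q' hq' h z hx' hzy

theorem card_bag_le [Fintype X] (T : TreeDecomposition G X) (hT : T.width ≤ 2) (x : X) :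
    (T.bag x).card ≤ 3 := by
  have := Finset.le_sup (f := fun x => (T.bag x).card) (Finset.mem_univ x)
  unfold width at hT
  omega

/-- Elimination in treewidth two: some vertex `w ≠ s` shares bags with at most two other vertices
of `S`, which share a bag themselves. -/
theorem exists_elimination [Fintype X] [DecidableEq V] (T : TreeDecomposition G X)
    (hT : T.width ≤ 2) {s : V} {S : Finset V} (hs : s ∈ S) (hS : S ≠ {s}) :
    ∃ w ∈ S, w ≠ s ∧ ∃ u ∈ S.erase w, ∃ v ∈ S.erase w, T.Share u v ∧
      ∀ z ∈ S.erase w, T.Share w z → z = u ∨ z = v := by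
  -- With the root at a bag of `s`, the top of `s` has depth zero, so the deepest top among the
  -- other vertices is deepest in all of `S`.
  obtain ⟨r, hr⟩ := T.vertex_mem s
  choose top htop hmin using T.exists_top r
  have hne : (S.erase s).Nonempty := by
    rw [Finset.nonempty_iff_ne_empty]
    intro h
    exact hS (by rw [← Finset.insert_erase hs, h]; rfl)
  obtain ⟨w, hw, hmax⟩ := Finset.exists_max_image (S.erase s) (fun v => T.tree.dist r (top v)) hne
  rw [Finset.mem_erase] at hw
  refine ⟨w, hw.2, hw.1, ?_⟩
  have hdist : ∀ z ∈ S, T.tree.dist r (top z) ≤ T.tree.dist r (top w) := by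
    intro z hz
    by_cases hzs : z = s
    · have := hmin z r (hzs ▸ hr)
      rw [SimpleGraph.dist_self] at this
      omega
    · exact hmax z (Finset.mem_erase.2 ⟨hzs, hz⟩)
  set N := (S.erase w).filter fun z => z ∈ T.bag (top w)
  have hN : ∀ z ∈ S.erase w, T.Share w z → z ∈ N := fun z hz hwz =>
    Finset.mem_filter.2 ⟨hz, T.mem_bag_of_share (htop w) (hmin w) (htop z) (hmin z)
      (hdist z (Finset.mem_of_mem_erase hz)) hwz⟩
  have hcard : N.card ≤ 2 := by
    have h1 : N ⊆ (T.bag (top w)).erase w := fun z hz => by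
      rw [Finset.mem_filter, Finset.mem_erase] at hz
      exact Finset.mem_erase.2 ⟨hz.1.1, hz.2⟩
    have h2 := Finset.card_le_card h1
    rw [Finset.card_erase_of_mem (htop w)] at h2
    have := T.card_bag_le hT (top w)
    omega
  have hNmem : ∀ z ∈ N, z ∈ S.erase w ∧ z ∈ T.bag (top w) := fun z hz => Finset.mem_filter.1 hz
  -- Without neighbours, `u = v = s` serves; with a single neighbour, `u = v` is that neighbour.
  rcases N.eq_empty_or_nonempty with h0 | ⟨u, hu⟩
  · have hsw : s ∈ S.erase w := Finset.mem_erase.2 ⟨hw.1.symm, hs⟩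
    refine ⟨s, hsw, s, hsw, ⟨r, hr, hr⟩, fun z hz hwz => ?_⟩
    have := hN z hz hwz
    simp [h0] at this
  · obtain ⟨v, hv, hsub⟩ : ∃ v ∈ N, ∀ z ∈ N, z = u ∨ z = v := by
      rcases (N.erase u).eq_empty_or_nonempty with h1 | ⟨v, hv⟩
      · refine ⟨u, hu, fun z hz => ?_⟩
        by_contra hzu
        push Not at hzu
        have : z ∈ N.erase u := Finset.mem_erase.2 ⟨hzu.1, hz⟩
        simp [h1] at this
      · rw [Finset.mem_erase] at hv
        have hpair : ({u, v} : Finset V) = N := by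
          refine Finset.eq_of_subset_of_card_le (fun z hz => ?_) ?_
          · simp only [Finset.mem_insert, Finset.mem_singleton] at hz
            rcases hz with rfl | rfl
            exacts [hu, hv.2]
          · rw [Finset.card_pair hv.1.symm]
            exact hcard
        refine ⟨v, hv.2, fun z hz => ?_⟩
        simpa [← hpair] using hz
    exact ⟨u, (hNmem u hu).1, v, (hNmem v hv).1, ⟨top w, (hNmem u hu).2, (hNmem v hv).2⟩,
      fun z hz hwz => hsub z (hN z hz hwz)⟩

end TreeDecomposition

/-! ### Link multiplicities and families of trees given by parent functions. -/

section Routing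

theorem sum_sum_add {V : Type*} [Fintype V] (m m' : V → V → ℕ) :
    ∑ x, ∑ y, (m + m') x y = (∑ x, ∑ y, m x y) + ∑ x, ∑ y, m' x y := by
  simp only [Pi.add_apply, Finset.sum_add_distrib]

variable {V K : Type*} [DecidableEq V]

/-- The multiplicity function with `n` links from `x` to `y` and no others. -/
def singleLink (x y : V) (n : ℕ) : V → V → ℕ :=
  fun x' y' => if x' = x ∧ y' = y then n else 0

/-- The number of links entering `U`, for link multiplicities `m`. -/
def cutSize [Fintype V] (m : V → V → ℕ) (U : Finset V) : ℕ :=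
  ∑ x, ∑ y, if x ∉ U ∧ y ∈ U then m x y else 0

theorem cutSize_add [Fintype V] (m m' : V → V → ℕ) (U : Finset V) :
    cutSize (m + m') U = cutSize m U + cutSize m' U := by
  simp only [cutSize, ← Finset.sum_add_distrib, Pi.add_apply]
  refine Finset.sum_congr rfl fun x _ => Finset.sum_congr rfl fun y _ => ?_
  split_ifs <;> rfl

theorem cutSize_singleLink [Fintype V] (x y : V) (n : ℕ) (U : Finset V) :
    cutSize (singleLink x y n) U = if x ∉ U ∧ y ∈ U then n else 0 := by
  unfold cutSize singleLink
  rw [Finset.sum_eq_single_of_mem x (Finset.mem_univ x), Finset.sum_eq_single_of_mem y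
    (Finset.mem_univ y)]
  · simp
  · intro b _ hb
    simp [hb]
  · intro b _ hb
    simp [hb]

theorem cutSize_congr [Fintype V] {m : V → V → ℕ} {w : V} (hw : ∀ x y, x = w ∨ y = w → m x y = 0)
    {U U' : Finset V} (h : ∀ x, x ≠ w → (x ∈ U ↔ x ∈ U')) : cutSize m U = cutSize m U' := by
  unfold cutSize
  refine Finset.sum_congr rfl fun x _ => Finset.sum_congr rfl fun y _ => ?_
  by_cases hxy : x = w ∨ y = w
  · simp [hw x y hxy]
  · rw [not_or] at hxy
    simp only [h x hxy.1, h y hxy.2]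

theorem cutSize_singleton [Fintype V] {m : V → V → ℕ} (y : V) (hm : m y y = 0) :
    cutSize m {y} = ∑ x, m x y := by
  unfold cutSize
  refine Finset.sum_congr rfl fun x _ => ?_
  rw [Finset.sum_eq_single_of_mem y (Finset.mem_univ y)]
  · by_cases hx : x = y
    · simp [hx, hm]
    · simp [hx]
  · intro b _ hb
    simp [hb]

theorem cutSize_le_sum [Fintype V] (m : V → V → ℕ) (U : Finset V) :
    cutSize m U ≤ ∑ x, ∑ y, m x y := by
  unfold cutSize
  refine Finset.sum_le_sum fun x _ => Finset.sum_le_sum fun y _ => ?_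
  split_ifs <;> simp

theorem sum_singleLink [Fintype V] (x y : V) (n : ℕ) :
    ∑ x', ∑ y', singleLink x y n x' y' = n := by
  unfold singleLink
  rw [Finset.sum_eq_single_of_mem x (Finset.mem_univ x), Finset.sum_eq_single_of_mem y
    (Finset.mem_univ y)]
  · simp
  · intro b _ hb
    simp [hb]
  · intro b _ hb
    simp [hb]

/-- `p i y = some x` means that the tree `i` enters `y` along a link from `x`. Each tree is
rooted at `s`, and the trees use exactly `m x y` links from `x` to `y`. -/
structure IsRouting [Fintype K] (s : V) (m : V → V → ℕ) (p : K → V → Option V) : Prop where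
  card_eq : ∀ x y, (Finset.univ.filter fun i => p i y = some x).card = m x y
  reach : ∀ i x y, p i y = some x → Relation.ReflTransGen (fun x y => p i y = some x) s y

/-- The set of trees that contain `y`. -/
def treesAt [Fintype K] (s : V) (p : K → V → Option V) (y : V) : Finset K :=
  Finset.univ.filter fun i => y = s ∨ p i y ≠ none

namespace IsRouting

variable [Fintype K] {s : V} {m : V → V → ℕ} {p : K → V → Option V}

theorem card_treesAt [Fintype V] (h : IsRouting s m p) {y : V} (hy : y ≠ s) :
    (treesAt s p y).card = ∑ x, m x y := by
  classical
  simp only [← h.card_eq, treesAt, hy, false_or]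
  rw [← Finset.card_biUnion]
  · congr 1
    ext i
    simp [Option.ne_none_iff_exists']
  · intro x _ x' _ hxx'
    rw [Function.onFun, Finset.disjoint_left]
    intro i hi hi'
    simp only [Finset.mem_filter, Finset.mem_univ, true_and] at hi hi'
    exact hxx' (Option.some.inj (hi.symm.trans hi'))

theorem ne_some (h : IsRouting s m p) {x y : V} (hxy : m x y = 0) (i : K) : p i y ≠ some x := by
  have := h.card_eq x y
  rw [hxy, Finset.card_eq_zero, Finset.filter_eq_empty_iff] at this
  exact this (Finset.mem_univ i)

theorem eq_none (h : IsRouting s m p) {y : V} (hy : ∀ x, m x y = 0) (i : K) : p i y = none :=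
  Option.eq_none_iff_forall_ne_some.2 fun x => h.ne_some (hy x) i

theorem reach_of_mem_treesAt (h : IsRouting s m p) {y : V} {i : K} (hi : i ∈ treesAt s p y) :
    Relation.ReflTransGen (fun x y => p i y = some x) s y := by
  simp only [treesAt, Finset.mem_filter, Finset.mem_univ, true_and] at hi
  rcases hi with rfl | hi
  · exact .refl
  · obtain ⟨x, hx⟩ := Option.ne_none_iff_exists'.1 hi
    exact h.reach i x y hx

/-- A tree has no directed cycle of length two. -/
theorem not_two_cycle (h : IsRouting s m p) (hs : ∀ x, m x s = 0) {u v : V} {i : K}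
    (huv : p i v = some u) (hvu : p i u = some v) : False := by
  -- The parents of `u` and `v` are each other, so no walk from the root can enter the pair.
  have key : ∀ y, Relation.ReflTransGen (fun x y => p i y = some x) s y → y ≠ u ∧ y ≠ v := by
    intro y hy
    induction hy with
    | refl =>
      refine ⟨?_, ?_⟩
      · rintro rfl
        exact h.ne_some (hs v) i hvu
      · rintro rfl
        exact h.ne_some (hs u) i huv
    | tail _ hstep ih =>
      refine ⟨?_, ?_⟩
      · rintro rfl
        exact ih.2 (Option.some.inj (hstep.symm.trans hvu))
      · rintro rfl
        exact ih.1 (Option.some.inj (hstep.symm.trans huv))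
  exact (key u (h.reach i v u hvu)).1 rfl

theorem mem_treesAt_of_eq_some (h : IsRouting s m p) (hs : ∀ x, m x s = 0) {x y : V} {i : K}
    (hxy : p i y = some x) : i ∈ treesAt s p x := by
  simp only [treesAt, Finset.mem_filter, Finset.mem_univ, true_and]
  have hreach := h.reach i x y hxy
  rcases Relation.ReflTransGen.cases_tail hreach with rfl | ⟨z, hsz, hzy⟩
  · exact absurd hxy (h.ne_some (hs x) i)
  · obtain rfl := Option.some.inj (hzy.symm.trans hxy)
    rcases Relation.ReflTransGen.cases_tail hsz with rfl | ⟨z', -, hz'⟩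
    · exact Or.inl rfl
    · exact Or.inr (by rw [hz']; simp)

end IsRouting

/-- `Cu`, `Cv` are the trees containing u, v; `Dv`, `Du` those to be rerouted on their way to v, u.
`C₁`, `C₂` are to receive w below u, below v. The last two bounds say that as many trees as possible
containing only one of u, v are used, which yields condition 2 for w. -/
theorem exists_tree_choice [DecidableEq K] {Cu Cv Du Dv : Finset K} {a b : ℕ}
    (hDv : Dv ⊆ Cu ∩ Cv) (hDu : Du ⊆ Cu ∩ Cv) (hdisj : Disjoint Du Dv) (ha : Dv.card ≤ a)
    (hb : Du.card ≤ b) (hab : a + b ≤ (Cu ∪ Cv).card) (hCv : b + Dv.card ≤ Cv.card)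
    (hCu : a + Du.card ≤ Cu.card) :
    ∃ C₁ C₂ : Finset K, Disjoint C₁ C₂ ∧ Dv ⊆ C₁ ∧ C₁ ⊆ Cu ∧ Du ⊆ C₂ ∧ C₂ ⊆ Cv ∧
      C₁.card = a ∧ C₂.card = b ∧
      min (b - Du.card) (Cv \ Cu).card ≤ ((C₁ ∪ C₂) \ Cu).card ∧
      min (a - Dv.card) (Cu \ Cv).card ≤ ((C₁ ∪ C₂) \ Cv).card := by
  have e1 := Finset.card_sdiff_add_card_inter Cu Cv
  have e2 := Finset.card_sdiff_add_card_inter Cv Cu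
  have e3 := Finset.card_union_add_card_inter Cu Cv
  rw [Finset.inter_comm] at e2
  have e4 : ((Cu ∩ Cv) \ (Du ∪ Dv)).card + (Du.card + Dv.card) = (Cu ∩ Cv).card := by
    rw [← Finset.card_union_of_disjoint hdisj]
    exact Finset.card_sdiff_add_card_eq_card (Finset.union_subset hDu hDv)
  -- `X` and `Y` exhaust the trees containing only one of u, v as far as needed; `M` and `N` fill up
  -- from the unused common trees.
  obtain ⟨X, hX, hXc⟩ := Finset.exists_subset_card_eq
    (show min (b - Du.card) (Cv \ Cu).card ≤ (Cv \ Cu).card from min_le_right _ _)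
  obtain ⟨Y, hY, hYc⟩ := Finset.exists_subset_card_eq
    (show min (a - Dv.card) (Cu \ Cv).card ≤ (Cu \ Cv).card from min_le_right _ _)
  obtain ⟨M, hM, hMc⟩ := Finset.exists_subset_card_eq
    (show b - Du.card - X.card ≤ ((Cu ∩ Cv) \ (Du ∪ Dv)).card by omega)
  have e5 := Finset.card_sdiff_add_card_eq_card hM
  obtain ⟨N, hN, hNc⟩ := Finset.exists_subset_card_eq
    (show a - Dv.card - Y.card ≤ (((Cu ∩ Cv) \ (Du ∪ Dv)) \ M).card by omega)
  have hX' : ∀ i ∈ X, i ∈ Cv ∧ i ∉ Cu := fun i hi => Finset.mem_sdiff.1 (hX hi)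
  have hY' : ∀ i ∈ Y, i ∈ Cu ∧ i ∉ Cv := fun i hi => Finset.mem_sdiff.1 (hY hi)
  have hM' : ∀ i ∈ M, i ∈ Cu ∧ i ∈ Cv ∧ i ∉ Du ∧ i ∉ Dv := fun i hi => by
    have := hM hi
    simp only [Finset.mem_sdiff, Finset.mem_inter, Finset.mem_union] at this
    tauto
  have hN' : ∀ i ∈ N, i ∈ Cu ∧ i ∈ Cv ∧ i ∉ Du ∧ i ∉ Dv ∧ i ∉ M := fun i hi => by
    have := hN hi
    simp only [Finset.mem_sdiff, Finset.mem_inter, Finset.mem_union] at this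
    tauto
  have hDu' : ∀ i ∈ Du, i ∈ Cu ∧ i ∈ Cv := fun i hi => Finset.mem_inter.1 (hDu hi)
  have hDv' : ∀ i ∈ Dv, i ∈ Cu ∧ i ∈ Cv := fun i hi => Finset.mem_inter.1 (hDv hi)
  have hdisj' : ∀ i ∈ Du, i ∉ Dv := fun i hi => Finset.disjoint_left.1 hdisj hi
  refine ⟨Dv ∪ Y ∪ N, Du ∪ X ∪ M, ?_, ?_, ?_, ?_, ?_, ?_, ?_, ?_, ?_⟩
  · rw [Finset.disjoint_left]
    intro i hi
    simp only [Finset.mem_union] at hi ⊢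
    grind
  · intro i hi
    simp [hi]
  · intro i hi
    simp only [Finset.mem_union] at hi
    grind
  · intro i hi
    simp [hi]
  · intro i hi
    simp only [Finset.mem_union] at hi
    grind
  · rw [Finset.card_union_of_disjoint, Finset.card_union_of_disjoint]
    · omega
    · rw [Finset.disjoint_left]
      grind
    · rw [Finset.disjoint_left]
      grind
  · rw [Finset.card_union_of_disjoint, Finset.card_union_of_disjoint]
    · omega
    · rw [Finset.disjoint_left]
      grind
    · rw [Finset.disjoint_left]
      grind
  · rw [← hXc]
    refine Finset.card_le_card fun i hi => ?_
    simp [hi, (hX' i hi).2]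
  · rw [← hYc]
    refine Finset.card_le_card fun i hi => ?_
    simp [hi, (hY' i hi).2]

namespace IsRouting

/-- Inserting the vertex `w`, which is entered along `a` links from `u` and `b` links from `v`, and
through which `d` of the links from `u` to `v` and `c` of those from `v` to `u` are rerouted. -/
theorem exists_extension [Fintype K] [DecidableEq K] {s w u v : V} {m₀ : V → V → ℕ}
    {p : K → V → Option V} {C₁ C₂ Du Dv : Finset K}
    (hm₀ : ∀ x y, x = w ∨ y = w → m₀ x y = 0) (huw : u ≠ w) (hvw : v ≠ w)
    (huv : u ≠ v ∨ C₂ = ∅ ∧ Du = ∅ ∧ Dv = ∅)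
    (h : IsRouting s (m₀ + singleLink u v Dv.card + singleLink v u Du.card) p)
    (hDu : ∀ i ∈ Du, p i u = some v) (hDv : ∀ i ∈ Dv, p i v = some u)
    (hC₁ : C₁ ⊆ treesAt s p u) (hC₂ : C₂ ⊆ treesAt s p v) (hdisj : Disjoint C₁ C₂)
    (hDvC : Dv ⊆ C₁) (hDuC : Du ⊆ C₂) (hws : w ≠ s) :
    ∃ p' : K → V → Option V,
      IsRouting s (m₀ + singleLink u w C₁.card + singleLink v w C₂.card +
        singleLink w u Du.card + singleLink w v Dv.card) p' ∧
      treesAt s p' w = C₁ ∪ C₂ ∧ ∀ y, y ≠ w → treesAt s p' y = treesAt s p y := by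
  have hdisj' : ∀ i ∈ C₁, i ∉ C₂ := fun i hi => Finset.disjoint_left.1 hdisj hi
  have hwnone : ∀ i, p i w = none := fun i => h.eq_none (fun x => by
    simp [singleLink, hm₀, huw.symm, hvw.symm]) i
  have hnotw : ∀ i y, p i y ≠ some w := fun i y => h.ne_some (by
    simp [singleLink, hm₀, huw.symm, hvw.symm]) i
  obtain ⟨p', hp'⟩ : ∃ p' : K → V → Option V, ∀ i y, p' i y =
      if y = w then (if i ∈ C₁ then some u else if i ∈ C₂ then some v else none)
      else if y = v ∧ i ∈ Dv then some w else if y = u ∧ i ∈ Du then some w else p i y :=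
    ⟨_, fun _ _ => rfl⟩
  have hother : ∀ y, y ≠ w → treesAt s p' y = treesAt s p y := by
    intro y hy
    ext i
    simp only [treesAt, Finset.mem_filter, Finset.mem_univ, true_and, hp', if_neg hy]
    split_ifs with h1 h2
    · simp [h1.1, hDv i h1.2]
    · simp [h2.1, hDu i h2.2]
    · rfl
  have hclosed : ∀ i x y, Relation.ReflTransGen (fun x y => p i y = some x) x y →
      Relation.ReflTransGen (fun x y => p' i y = some x) x y := by
    intro i x y
    refine Relation.reflTransGen_closed (fun x y hxy => ?_) x y
    have hy : y ≠ w := by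
      rintro rfl
      simp [hwnone] at hxy
    -- A step u→v in a tree of `Dv` becomes u→w→v; as `Dv ⊆ C₁`, the parent of `w` there is indeed
    -- `u`. Symmetrically for `Du`.
    by_cases h1 : y = v ∧ i ∈ Dv
    · obtain ⟨rfl, hi⟩ := h1
      obtain rfl := Option.some.inj ((hDv i hi).symm.trans hxy)
      exact (Relation.ReflTransGen.single (b := w) (by simp [hp', hDvC hi])).tail
        (by simp [hp', hy, hi])
    · by_cases h2 : y = u ∧ i ∈ Du
      · obtain ⟨rfl, hi⟩ := h2
        obtain rfl := Option.some.inj ((hDu i hi).symm.trans hxy)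
        have hi1 : i ∉ C₁ := fun hi1 => hdisj' i hi1 (hDuC hi)
        exact (Relation.ReflTransGen.single (b := w) (by simp [hp', hi1, hDuC hi])).tail
          (by simp [hp', hy, hi])
      · exact .single (by simp [hp', hy, h1, h2, hxy])
  refine ⟨p', ⟨fun x y => ?_, fun i x y hxy => ?_⟩, ?_, hother⟩
  · by_cases hy : y = w
    · subst hy
      have hmem : ∀ i, p' i y = some x ↔ (i ∈ C₁ ∧ u = x) ∨ (i ∈ C₂ ∧ v = x) := by
        intro i
        have := hdisj' i
        simp only [hp', if_true]
        split_ifs with h1 h2 <;> simp [*]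
      simp only [hmem]
      by_cases hxu : x = u
      · subst hxu
        rcases huv with huv | ⟨rfl, rfl, rfl⟩
        · simp [singleLink, hm₀, huw, hvw.symm, huw.symm, huv, huv.symm]
        · simp [singleLink, hm₀, huw, hvw.symm, huw.symm]
      · by_cases hxv : x = v
        · subst hxv
          simp [singleLink, hm₀, hvw, hvw.symm, huw.symm, hxu, Ne.symm hxu]
        · simp [singleLink, hm₀, hvw.symm, huw.symm, hxu, hxv, Ne.symm hxu, Ne.symm hxv]
    · have hcard := h.card_eq x y
      simp only [hp', if_neg hy]
      by_cases hx : x = w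
      · subst hx
        have hmem : ∀ i, (if y = v ∧ i ∈ Dv then some x else if y = u ∧ i ∈ Du then some x
            else p i y) = some x ↔ (y = v ∧ i ∈ Dv) ∨ (y = u ∧ i ∈ Du) := by
          intro i
          split_ifs with h1 h2 <;> simp [*]
        simp only [hmem]
        by_cases hyu : y = u
        · subst hyu
          rcases huv with huv | ⟨rfl, rfl, rfl⟩
          · simp [singleLink, hm₀, huw.symm, hvw.symm, huv, huw]
          · simp [singleLink, hm₀, huw.symm, hvw.symm, huw]
        · by_cases hyv : y = v
          · subst hyv
            simp [singleLink, hm₀, huw.symm, hvw.symm, hvw, hyu]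
          · simp [singleLink, hm₀, huw.symm, hvw.symm, hy, hyu, hyv]
      · have hmem : ∀ i, (if y = v ∧ i ∈ Dv then some w else if y = u ∧ i ∈ Du then some w
            else p i y) = some x ↔ p i y = some x ∧ ¬ (y = v ∧ i ∈ Dv) ∧ ¬ (y = u ∧ i ∈ Du) := by
          intro i
          split_ifs with h1 h2 <;> simp [Ne.symm hx, *]
        simp only [hmem]
        have hDuf : Du ⊆ Finset.univ.filter fun i => p i u = some v := fun i hi => by
          simp [hDu i hi]
        have hDvf : Dv ⊆ Finset.univ.filter fun i => p i v = some u := fun i hi => by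
          simp [hDv i hi]
        rcases huv with huv | ⟨rfl, rfl, rfl⟩
        · by_cases hyv : y = v
          · subst hyv
            by_cases hxu : x = u
            · subst hxu
              have := Finset.card_sdiff_add_card_eq_card hDvf
              have e : (Finset.univ.filter fun i => p i y = some x ∧ ¬ (y = y ∧ i ∈ Dv) ∧
                  ¬ (y = x ∧ i ∈ Du)) = (Finset.univ.filter fun i => p i y = some x) \ Dv := by
                ext i
                simp [huv.symm]
              rw [e]
              simp [singleLink, huv, huv.symm, huw, hvw] at hcard ⊢
              omega
            · have e : (Finset.univ.filter fun i => p i y = some x ∧ ¬ (y = y ∧ i ∈ Dv) ∧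
                  ¬ (y = u ∧ i ∈ Du)) = (Finset.univ.filter fun i => p i y = some x) := by
                ext i
                have := hDv i
                simp only [Finset.mem_filter, Finset.mem_univ, true_and, huv.symm, false_and,
                  not_false_iff, and_true, and_iff_left_iff_imp]
                intro h1 h2
                exact hxu (Option.some.inj (h1.symm.trans (this h2)))
              rw [e, hcard]
              simp [singleLink, hxu, huv.symm, hx, hvw]
          · by_cases hyu : y = u
            · subst hyu
              by_cases hxv : x = v
              · subst hxv
                have := Finset.card_sdiff_add_card_eq_card hDuf
                have e : (Finset.univ.filter fun i => p i y = some x ∧ ¬ (y = x ∧ i ∈ Dv) ∧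
                    ¬ (y = y ∧ i ∈ Du)) = (Finset.univ.filter fun i => p i y = some x) \ Du := by
                  ext i
                  simp [huv]
                rw [e]
                simp [singleLink, huv, huv.symm, huw, hvw] at hcard ⊢
                omega
              · have e : (Finset.univ.filter fun i => p i y = some x ∧ ¬ (y = v ∧ i ∈ Dv) ∧
                    ¬ (y = y ∧ i ∈ Du)) = (Finset.univ.filter fun i => p i y = some x) := by
                  ext i
                  have := hDu i
                  simp only [Finset.mem_filter, Finset.mem_univ, true_and, huv, false_and,
                    not_false_iff, true_and, and_iff_left_iff_imp]
                  intro h1 h2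
                  exact hxv (Option.some.inj (h1.symm.trans (this h2)))
                rw [e, hcard]
                simp [singleLink, hxv, huv, hx, huw]
            · simp [singleLink, hyu, hyv, hy] at hcard ⊢
              omega
        · simp [singleLink, hy] at hcard ⊢
          omega
  · by_cases hy : y = w
    · subst hy
      have hxy' := hxy
      simp only [hp', if_true] at hxy'
      split_ifs at hxy' with h1 h2
      · obtain rfl := Option.some.inj hxy'
        exact (hclosed i s u (h.reach_of_mem_treesAt (hC₁ h1))).tail hxy
      · obtain rfl := Option.some.inj hxy'
        exact (hclosed i s v (h.reach_of_mem_treesAt (hC₂ h2))).tail hxy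
    · refine hclosed i s y (h.reach_of_mem_treesAt ?_)
      rw [← hother y hy]
      simp [treesAt, hxy]
  · ext i
    simp only [treesAt, Finset.mem_filter, Finset.mem_univ, true_and, hp', if_true, hws,
      Finset.mem_union, false_or]
    split_ifs with h1 h2 <;> simp [*]

end IsRouting

/-! ### Eliminating one vertex: cuts and routings before and after. -/

/-- The multiplicities `m₀` with `a` links from `u` to `w`, `b` from `v` to `w`, `c` from `w` to `u`
and `d` from `w` to `v` added. -/
def splitLinks (m₀ : V → V → ℕ) (w u v : V) (a b c d : ℕ) : V → V → ℕ :=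
  m₀ + singleLink u w a + singleLink v w b + singleLink w u c + singleLink w v d

/-- The multiplicities `m₀` with `d` links from `u` to `v` and `c` from `v` to `u` added. -/
def mergeLinks (m₀ : V → V → ℕ) (u v : V) (c d : ℕ) : V → V → ℕ :=
  m₀ + singleLink u v d + singleLink v u c

/-- Multiplicities `m` on `S` split along a vertex `w` all of whose neighbours are `u` and `v`. -/
theorem eq_splitLinks {m : V → V → ℕ} {w u v : V} (hww : m w w = 0) (huw : u ≠ w)
    (hvw : v ≠ w) (hin : ∀ x, m x w ≠ 0 → x = u ∨ x = v) (hout : ∀ y, m w y ≠ 0 → y = u ∨ y = v) :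
    m = splitLinks (fun x y => if x = w ∨ y = w then 0 else m x y) w u v (m u w)
      (if v = u then 0 else m v w) (m w u) (if v = u then 0 else m w v) := by
  funext x y
  simp only [splitLinks, Pi.add_apply, singleLink]
  by_cases hx : x = w
  · subst hx
    by_cases hyu : y = u
    · subst hyu
      by_cases hvy : v = y
      · simp [huw, huw.symm, hvy]
      · simp [huw, huw.symm, hvw.symm, Ne.symm hvy]
    · by_cases hyv : y = v
      · subst hyv
        simp [huw.symm, hvw, hyu]
      · have : m x y = 0 := by
          by_contra h0
          rcases hout y h0 with h | h
          exacts [hyu h, hyv h]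
        simp [huw.symm, hvw.symm, hyu, hyv, this]
  · by_cases hy : y = w
    · subst hy
      by_cases hxu : x = u
      · subst hxu
        by_cases hvx : v = x
        · simp [huw.symm, hx, hvx]
        · simp [huw, huw.symm, hvw.symm, Ne.symm hvx]
      · by_cases hxv : x = v
        · subst hxv
          simp [huw.symm, hx, hxu]
        · have : m x y = 0 := by
            by_contra h0
            rcases hin x h0 with h | h
            exacts [hxu h, hxv h]
          simp [hx, hxu, hxv, this]
    · simp [hx, hy]

theorem card_treesAt_union_eq [Fintype K] [DecidableEq K] {s x y : V} (p : K → V → Option V)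
    (h : x = s ∨ y = s) : (treesAt s p x ∪ treesAt s p y).card = Fintype.card K := by
  rw [← Finset.card_univ]
  congr 1
  ext i
  rcases h with rfl | rfl <;> simp [treesAt]

section Step

variable {m₀ : V → V → ℕ} {w u v s : V} {a b c d : ℕ}

theorem cutSize_splitLinks [Fintype V] (U : Finset V) :
    cutSize (splitLinks m₀ w u v a b c d) U = cutSize m₀ U + (if u ∉ U ∧ w ∈ U then a else 0) +
      (if v ∉ U ∧ w ∈ U then b else 0) + (if w ∉ U ∧ u ∈ U then c else 0) +
      (if w ∉ U ∧ v ∈ U then d else 0) := by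
  simp only [splitLinks, cutSize_add, cutSize_singleLink]

theorem cutSize_mergeLinks [Fintype V] (U : Finset V) :
    cutSize (mergeLinks m₀ u v c d) U = cutSize m₀ U + (if u ∉ U ∧ v ∈ U then d else 0) +
      (if v ∉ U ∧ u ∈ U then c else 0) := by
  simp only [mergeLinks, cutSize_add, cutSize_singleLink]

theorem sum_splitLinks [Fintype V] : ∑ x, ∑ y, splitLinks m₀ w u v a b c d x y =
    (∑ x, ∑ y, m₀ x y) + a + b + c + d := by
  simp only [splitLinks, sum_sum_add, sum_singleLink]

theorem sum_mergeLinks [Fintype V] : ∑ x, ∑ y, mergeLinks m₀ u v c d x y =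
    (∑ x, ∑ y, m₀ x y) + d + c := by
  simp only [mergeLinks, sum_sum_add, sum_singleLink]

theorem cutSize_insert_of_isolated [Fintype V] (hm₀ : ∀ x y, x = w ∨ y = w → m₀ x y = 0)
    (U : Finset V) : cutSize m₀ (insert w U) = cutSize m₀ U :=
  cutSize_congr hm₀ fun x hx => by simp [hx]

theorem cutSize_erase_of_isolated [Fintype V] (hm₀ : ∀ x y, x = w ∨ y = w → m₀ x y = 0)
    (U : Finset V) : cutSize m₀ (U.erase w) = cutSize m₀ U :=
  cutSize_congr hm₀ fun x hx => by simp [hx]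

theorem cutSize_splitLinks_singleton [Fintype V] (hm₀ : ∀ x y, x = w ∨ y = w → m₀ x y = 0)
    (huw : u ≠ w) (hvw : v ≠ w) : cutSize (splitLinks m₀ w u v a b c d) {w} = a + b := by
  have hw0 : cutSize m₀ {w} = 0 := by
    have := cutSize_insert_of_isolated hm₀ ∅
    rw [insert_empty_eq] at this
    rw [this]
    simp [cutSize]
  rw [cutSize_splitLinks, hw0]
  simp [huw, hvw]

/-- Every cut of the merged network is a cut of the split network. -/
theorem exists_cutSize_splitLinks_eq [Fintype V] (hm₀ : ∀ x y, x = w ∨ y = w → m₀ x y = 0)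
    (huw : u ≠ w) (hvw : v ≠ w) (hdeg : u ≠ v ∨ b = 0 ∧ c = 0 ∧ d = 0) (U : Finset V) :
    ∃ U' : Finset V, (∀ x, x ≠ w → (x ∈ U' ↔ x ∈ U)) ∧ (u ∈ U → v ∈ U → w ∈ U') ∧
      cutSize (splitLinks m₀ w u v a b c d) U' = cutSize (mergeLinks m₀ u v c d) U := by
  -- Let `w` join the set exactly when both `u` and `v` are in it. Then no link into `w` crosses,
  -- and a link leaving `w` crosses exactly when its merged copy does.
  by_cases huvU : u ∈ U ∧ v ∈ U
  · refine ⟨insert w U, fun x hx => by simp [hx], fun _ _ => by simp, ?_⟩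
    rw [cutSize_splitLinks, cutSize_mergeLinks, cutSize_insert_of_isolated hm₀]
    simp [huvU]
  · refine ⟨U.erase w, fun x hx => by simp [hx], fun h1 h2 => absurd ⟨h1, h2⟩ huvU, ?_⟩
    rw [cutSize_splitLinks, cutSize_mergeLinks, cutSize_erase_of_isolated hm₀]
    rcases hdeg with - | ⟨rfl, rfl, rfl⟩
    · rw [not_and_or] at huvU
      rcases huvU with h1 | h1 <;> simp [h1, huw, hvw]
    · simp

/-- In-degrees away from `w` survive, because a link leaving `w` keeps its head when merged. -/
theorem cutSize_mergeLinks_singleton [Fintype V] {x : V} (huw : u ≠ w) (hvw : v ≠ w) (hdeg : u ≠ v ∨ b = 0 ∧ c = 0 ∧ d = 0) (hx : x ≠ w) :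
    cutSize (mergeLinks m₀ u v c d) {x} = cutSize (splitLinks m₀ w u v a b c d) {x} := by
  rw [cutSize_splitLinks, cutSize_mergeLinks]
  rcases hdeg with h | ⟨rfl, rfl, rfl⟩
  · by_cases h1 : u = x
    · subst h1
      simp [h.symm, huw.symm]
    · by_cases h2 : v = x
      · subst h2
        simp [h, hvw.symm]
      · simp [h1, h2, hx.symm]
  · simp [hx.symm]

theorem mergeLinks_self (hm₀ : ∀ x, m₀ x x = 0) (hdeg : u ≠ v ∨ b = 0 ∧ c = 0 ∧ d = 0) (x : V) :
    mergeLinks m₀ u v c d x x = 0 := by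
  rcases hdeg with h | ⟨rfl, rfl, rfl⟩
  · by_cases h1 : x = u
    · simp [mergeLinks, singleLink, hm₀, h1, h]
    · simp [mergeLinks, singleLink, hm₀, h1]
  · simp [mergeLinks, singleLink, hm₀]

/-- Extending a routing of the merged network to the split network. -/
theorem exists_isRouting_splitLinks [Fintype V] [Fintype K] [DecidableEq K]
    {p : K → V → Option V} (hm₀ : ∀ x y, x = w ∨ y = w → m₀ x y = 0) (hm₀s : ∀ x, m₀ x s = 0)
    (hm₀l : ∀ x, m₀ x x = 0)
    (huw : u ≠ w) (hvw : v ≠ w) (hws : w ≠ s) (hdeg : u ≠ v ∨ b = 0 ∧ c = 0 ∧ d = 0)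
    (hc0 : u = s → c = 0) (hd0 : v = s → d = 0)
    (hcut : ∀ x U, x ∈ U → s ∉ U → cutSize (splitLinks m₀ w u v a b c d) {x} ≤
      cutSize (splitLinks m₀ w u v a b c d) U)
    (hcb : c ≤ b) (hda : d ≤ a)
    (hK : ∑ x, ∑ y, splitLinks m₀ w u v a b c d x y ≤ Fintype.card K)
    (h : IsRouting s (mergeLinks m₀ u v c d) p)
    (hpair : u ≠ s → v ≠ s → ∃ U : Finset V, u ∈ U ∧ v ∈ U ∧ s ∉ U ∧
      cutSize (mergeLinks m₀ u v c d) U ≤ (treesAt s p u ∪ treesAt s p v).card) :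
    ∃ p' : K → V → Option V, IsRouting s (splitLinks m₀ w u v a b c d) p' ∧
      (∀ y, y ≠ w → treesAt s p' y = treesAt s p y) ∧
      (u ≠ s → ∃ U : Finset V, w ∈ U ∧ u ∈ U ∧ s ∉ U ∧
        cutSize (splitLinks m₀ w u v a b c d) U ≤ (treesAt s p' w ∪ treesAt s p' u).card) ∧
      (v ≠ s → ∃ U : Finset V, w ∈ U ∧ v ∈ U ∧ s ∉ U ∧
        cutSize (splitLinks m₀ w u v a b c d) U ≤ (treesAt s p' w ∪ treesAt s p' v).card) := by
  have hK' := hK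
  rw [sum_splitLinks] at hK'
  have hcutK : ∀ U, cutSize (splitLinks m₀ w u v a b c d) U ≤ Fintype.card K := fun U =>
    (cutSize_le_sum _ U).trans hK
  have hcw := cutSize_splitLinks_singleton (a := a) (b := b) (c := c) (d := d) hm₀ huw hvw
  have hcard : ∀ x, x ≠ s → x ≠ w → (treesAt s p x).card =
      cutSize (splitLinks m₀ w u v a b c d) {x} := fun x hxs hxw => by
    rw [h.card_treesAt hxs, ← cutSize_singleton x (mergeLinks_self hm₀l hdeg x)]
    exact cutSize_mergeLinks_singleton huw hvw hdeg hxw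
  have hcards : ∀ x, x = s → (treesAt s p x).card = Fintype.card K := fun x hx => by
    have := card_treesAt_union_eq (y := x) p (Or.inl hx)
    rwa [Finset.union_self] at this
  -- Passing from `{u}` to `{w, u}` loses the `c` links from `w` and gains the `b` links from `v`.
  have hcutu : cutSize (splitLinks m₀ w u v a b c d) {w, u} + c =
      cutSize (splitLinks m₀ w u v a b c d) {u} + b := by
    rw [cutSize_splitLinks, cutSize_splitLinks, cutSize_insert_of_isolated hm₀]
    rcases hdeg with h | ⟨rfl, rfl, rfl⟩
    · simp [huw.symm, hvw, h.symm]
      omega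
    · simp [huw.symm]
  have hcutv : cutSize (splitLinks m₀ w u v a b c d) {w, v} + d =
      cutSize (splitLinks m₀ w u v a b c d) {v} + (if u = v then 0 else a) := by
    rw [cutSize_splitLinks, cutSize_splitLinks, cutSize_insert_of_isolated hm₀]
    rcases hdeg with h | ⟨rfl, rfl, rfl⟩
    · simp [hvw.symm, huw, h]
      omega
    · by_cases huv : u = v
      · simp [hvw.symm, huv]
      · simp [hvw.symm, huw, huv]
  have hcut2 : ∀ x, x ≠ s → cutSize (splitLinks m₀ w u v a b c d) {w} ≤
      cutSize (splitLinks m₀ w u v a b c d) {w, x} := fun x hx =>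
    hcut w {w, x} (by simp) (by simp [hws.symm, hx.symm])
  -- `a + b` is the in-degree of `w`, hence at most any cut around `u`, `v`, `w`, and condition 2
  -- for `u`, `v` supplies such a cut. If one of them is `s`, all trees count.
  have hab : a + b ≤ (treesAt s p u ∪ treesAt s p v).card := by
    by_cases hus : u = s
    · rw [card_treesAt_union_eq p (Or.inl hus)]
      omega
    by_cases hvs : v = s
    · rw [card_treesAt_union_eq p (Or.inr hvs)]
      omega
    obtain ⟨U, huU, hvU, hsU, hU⟩ := hpair hus hvs
    obtain ⟨U', hU', hwU', heq⟩ := exists_cutSize_splitLinks_eq (a := a) hm₀ huw hvw hdeg U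
    have := hcut w U' (hwU' huU hvU) (by rwa [hU' s hws.symm])
    omega
  -- The in-degree `a + b` of `w` is at most the cut of `{w, u}`, which is the in-degree of `u` plus
  -- `b - c`.
  have hCu : a + c ≤ (treesAt s p u).card := by
    by_cases hus : u = s
    · rw [hcards u hus]
      omega
    · rw [hcard u hus huw]
      have := hcut2 u hus
      omega
  have hCv : b + d ≤ (treesAt s p v).card := by
    by_cases hvs : v = s
    · rw [hcards v hvs]
      omega
    · rw [hcard v hvs hvw]
      have := hcut2 v hvs
      split_ifs at hcutv with huv
      · have : b = 0 ∧ c = 0 ∧ d = 0 := hdeg.resolve_left (not_not.2 huv)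
        omega
      · omega
  have hms : ∀ x, mergeLinks m₀ u v c d x s = 0 := fun x => by
    have h1 : (if x = u ∧ s = v then d else 0) = 0 := by
      split_ifs with h'
      exacts [hd0 h'.2.symm, rfl]
    have h2 : (if x = v ∧ s = u then c else 0) = 0 := by
      split_ifs with h'
      exacts [hc0 h'.2.symm, rfl]
    simp only [mergeLinks, Pi.add_apply, singleLink, hm₀s, h1, h2]
  obtain ⟨Du, hDu, hDuc⟩ : ∃ Du ⊆ Finset.univ.filter fun i => p i u = some v, Du.card = c := by
    refine Finset.exists_subset_card_eq ?_
    rw [h.card_eq]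
    simp [mergeLinks, singleLink]
  obtain ⟨Dv, hDv, hDvc⟩ : ∃ Dv ⊆ Finset.univ.filter fun i => p i v = some u, Dv.card = d := by
    refine Finset.exists_subset_card_eq ?_
    rw [h.card_eq]
    simp only [mergeLinks, Pi.add_apply, singleLink, and_self, if_true]
    omega
  have hDu' : ∀ i ∈ Du, p i u = some v := fun i hi => by simpa using hDu hi
  have hDv' : ∀ i ∈ Dv, p i v = some u := fun i hi => by simpa using hDv hi
  have hmem : ∀ i x y, p i y = some x → i ∈ treesAt s p x ∧ i ∈ treesAt s p y := fun i x y hi =>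
    ⟨h.mem_treesAt_of_eq_some hms hi, by simp [treesAt, hi]⟩
  subst hDuc hDvc
  obtain ⟨C₁, C₂, hdisj, hDvC, hC₁, hDuC, hC₂, rfl, rfl, hmin₁, hmin₂⟩ :=
    exists_tree_choice (Cu := treesAt s p u) (Cv := treesAt s p v) (Du := Du) (Dv := Dv)
      (fun i hi => Finset.mem_inter.2 (hmem i _ _ (hDv' i hi)))
      (fun i hi => Finset.mem_inter.2 (hmem i _ _ (hDu' i hi)).symm)
      (Finset.disjoint_left.2 fun i hi hi' => h.not_two_cycle hms (hDu' i hi) (hDv' i hi'))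
      hda hcb hab hCv hCu
  obtain ⟨p', hp', hw', hother⟩ := h.exists_extension hm₀ huw hvw
    (hdeg.imp_right fun h => ⟨Finset.card_eq_zero.1 h.1, Finset.card_eq_zero.1 h.2.1,
      Finset.card_eq_zero.1 h.2.2⟩) hDu' hDv' hC₁ hC₂ hdisj hDvC hDuC hws
  have hunion : u ≠ s → v ≠ s → ∃ U : Finset V, w ∈ U ∧ u ∈ U ∧ v ∈ U ∧ s ∉ U ∧
      cutSize (splitLinks m₀ w u v C₁.card C₂.card Du.card Dv.card) U ≤
        (treesAt s p u ∪ treesAt s p v).card := fun hus hvs => by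
    obtain ⟨U, huU, hvU, hsU, hU⟩ := hpair hus hvs
    obtain ⟨U', hU', hwU', heq⟩ :=
      exists_cutSize_splitLinks_eq (a := C₁.card) hm₀ huw hvw hdeg U
    exact ⟨U', hwU' huU hvU, (hU' u huw).2 huU, (hU' v hvw).2 hvU, by rwa [hU' s hws.symm],
      heq.trans_le hU⟩
  have e3 := Finset.card_sdiff_add_card (treesAt s p v) (treesAt s p u)
  have e4 := Finset.card_sdiff_add_card (treesAt s p u) (treesAt s p v)
  rw [Finset.union_comm] at e3
  refine ⟨p', hp', hother, fun hus => ?_, fun hvs => ?_⟩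
  · rw [hw', hother u huw, ← Finset.card_sdiff_add_card]
    -- Either `w` adds at least `b - c` trees to those at `u`, matching the cut of `{w, u}`, or it
    -- adds all trees containing `v` only, and the cut for the pair `u`, `v` applies.
    rcases min_le_iff.1 hmin₁ with hle | hle
    · refine ⟨{w, u}, by simp, by simp, by simp [hws.symm, Ne.symm hus], ?_⟩
      have := hcard u hus huw
      omega
    · by_cases hvs : v = s
      · refine ⟨{w, u}, by simp, by simp, by simp [hws.symm, Ne.symm hus], ?_⟩
        have := hcutK {w, u}
        rw [card_treesAt_union_eq p (Or.inr hvs)] at e3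
        omega
      · obtain ⟨U, h1, h2, -, h3, h4⟩ := hunion hus hvs
        exact ⟨U, h1, h2, h3, by omega⟩
  · rw [hw', hother v hvw, ← Finset.card_sdiff_add_card]
    rcases min_le_iff.1 hmin₂ with hle | hle
    · refine ⟨{w, v}, by simp, by simp, by simp [hws.symm, Ne.symm hvs], ?_⟩
      have := hcard v hvs hvw
      split_ifs at hcutv <;> omega
    · by_cases hus : u = s
      · refine ⟨{w, v}, by simp, by simp, by simp [hws.symm, Ne.symm hvs], ?_⟩
        have := hcutK {w, v}
        rw [card_treesAt_union_eq p (Or.inl hus)] at e4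
        omega
      · obtain ⟨U, h1, -, h2, h3, h4⟩ := hunion hus hvs
        exact ⟨U, h1, h2, h3, by omega⟩

end Step

/-- Induction on `S` by elimination. `R` stands for sharing a bag. `K` has at least as many indices
as there are links, which gives enough trees when a neighbour of `w` is `s`; some trees may consist
of `s` alone. -/
theorem exists_isRouting [Fintype V] [Fintype K] [DecidableEq K] {s : V} {R : V → V → Prop}
    (hR : ∀ x y, R x y → R y x)
    (helim : ∀ S : Finset V, s ∈ S → S ≠ {s} → ∃ w ∈ S, w ≠ s ∧ ∃ u ∈ S.erase w,
      ∃ v ∈ S.erase w, R u v ∧ ∀ z ∈ S.erase w, R w z → z = u ∨ z = v)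
    (S : Finset V) (hs : s ∈ S) (m : V → V → ℕ)
    (hm : ∀ x y, m x y ≠ 0 → x ∈ S ∧ y ∈ S ∧ R x y ∧ y ≠ s ∧ x ≠ y)
    (hcut : ∀ x U, x ∈ U → s ∉ U → cutSize m {x} ≤ cutSize m U)
    (hK : ∑ x, ∑ y, m x y ≤ Fintype.card K) :
    ∃ p : K → V → Option V, IsRouting s m p ∧
      ∀ x ∈ S, ∀ y ∈ S, x ≠ s → y ≠ s → R x y → ∃ U : Finset V, x ∈ U ∧ y ∈ U ∧ s ∉ U ∧
        cutSize m U ≤ (treesAt s p x ∪ treesAt s p y).card := by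
  induction S using Finset.strongInduction generalizing m with
  | H S ih =>
  by_cases hS : S = {s}
  · subst hS
    have hm0 : ∀ x y, m x y = 0 := fun x y => by
      by_contra h0
      exact (hm x y h0).2.2.2.1 (Finset.mem_singleton.1 (hm x y h0).2.1)
    exact ⟨fun _ _ => none, ⟨fun x y => by simp [hm0], fun i x y h => by simp at h⟩,
      fun x hx y _ hxs => absurd (Finset.mem_singleton.1 hx) hxs⟩
  obtain ⟨w, hwS, hws, u, huS, v, hvS, hRuv, hnb⟩ := helim S hs hS
  have huw := (Finset.mem_erase.1 huS).1
  have hvw := (Finset.mem_erase.1 hvS).1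
  have hloop : ∀ x, m x x = 0 := fun x => by
    by_contra h0
    exact (hm x x h0).2.2.2.2 rfl
  have hms : ∀ x, m x s = 0 := fun x => by
    by_contra h0
    exact (hm x s h0).2.2.2.1 rfl
  -- If `u = v`, all links at `w` are counted in `a` and `c`, while `b = d = 0`; the bound `c ≤ b`
  -- below then gives `c = 0`.
  obtain ⟨m₀, a, b, c, d, rfl, hm₀, hm₀m, hdeg, hc0, hd0⟩ : ∃ m₀ a b c d,
      m = splitLinks m₀ w u v a b c d ∧ (∀ x y, x = w ∨ y = w → m₀ x y = 0) ∧
      (∀ x y, m₀ x y ≠ 0 → x ≠ w ∧ y ≠ w ∧ m x y ≠ 0) ∧ (u ≠ v ∨ b = 0 ∧ d = 0) ∧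
      (u = s → c = 0) ∧ (v = s → d = 0) := by
    refine ⟨_, _, _, _, _, eq_splitLinks (hloop w) huw hvw (fun x h0 => ?_) (fun y h0 => ?_),
      fun x y h => if_pos h, fun x y h => ?_, ?_, fun h => h ▸ hms w, fun h => ?_⟩
    · obtain ⟨h1, -, h2, -, h3⟩ := hm x w h0
      exact hnb x (Finset.mem_erase.2 ⟨h3, h1⟩) (hR _ _ h2)
    · obtain ⟨-, h1, h2, -, h3⟩ := hm w y h0
      exact hnb y (Finset.mem_erase.2 ⟨h3.symm, h1⟩) h2
    · by_cases hxy : x = w ∨ y = w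
      · simp [hxy] at h
      · rw [if_neg hxy] at h
        exact ⟨fun h' => hxy (Or.inl h'), fun h' => hxy (Or.inr h'), h⟩
    · by_cases h : u = v <;> simp [h]
    · split_ifs
      exacts [rfl, h ▸ hms w]
  have hcb : c ≤ b := by
    by_cases hus : u = s
    · simp [hc0 hus]
    have := hcut u {w, u} (by simp) (by simp [hws.symm, Ne.symm hus])
    rw [cutSize_splitLinks, cutSize_splitLinks, cutSize_insert_of_isolated hm₀] at this
    rcases hdeg with h | ⟨rfl, rfl⟩
    · simpa [huw.symm, hvw, h.symm, add_assoc] using this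
    · simpa [huw.symm, hvw, add_assoc] using this
  have hda : d ≤ a := by
    by_cases hvs : v = s
    · simp [hd0 hvs]
    rcases hdeg with h | ⟨rfl, rfl⟩
    · have := hcut v {w, v} (by simp) (by simp [hws.symm, Ne.symm hvs])
      rw [cutSize_splitLinks, cutSize_splitLinks, cutSize_insert_of_isolated hm₀] at this
      simpa [hvw.symm, huw, h, add_assoc] using this
    · exact Nat.zero_le _
  replace hdeg : u ≠ v ∨ b = 0 ∧ c = 0 ∧ d = 0 :=
    hdeg.imp_right fun h => ⟨h.1, by omega, h.2⟩
  have hm₀s : ∀ x, m₀ x s = 0 := fun x => by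
    by_contra h
    exact (hm₀m x s h).2.2 (hms x)
  have hm₀l : ∀ x, m₀ x x = 0 := fun x => by
    by_contra h
    exact (hm₀m x x h).2.2 (hloop x)
  have hmerge : ∀ x y, mergeLinks m₀ u v c d x y ≠ 0 →
      x ∈ S.erase w ∧ y ∈ S.erase w ∧ R x y ∧ y ≠ s ∧ x ≠ y := by
    intro x y h
    have hor : m₀ x y ≠ 0 ∨ (x = u ∧ y = v ∧ d ≠ 0) ∨ (x = v ∧ y = u ∧ c ≠ 0) := by
      by_contra hcon
      push Not at hcon
      refine h ?_
      simp only [mergeLinks, Pi.add_apply, singleLink, hcon.1]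
      have h1 : (if x = u ∧ y = v then d else 0) = 0 := by
        split_ifs with h
        exacts [hcon.2.1 h.1 h.2, rfl]
      have h2 : (if x = v ∧ y = u then c else 0) = 0 := by
        split_ifs with h
        exacts [hcon.2.2 h.1 h.2, rfl]
      rw [h1, h2]
    clear h
    rcases hor with h | ⟨rfl, rfl, h⟩ | ⟨rfl, rfl, h⟩
    · obtain ⟨h1, h2, h3⟩ := hm₀m x y h
      obtain ⟨h4, h5, h6⟩ := hm x y h3
      exact ⟨Finset.mem_erase.2 ⟨h1, h4⟩, Finset.mem_erase.2 ⟨h2, h5⟩, h6⟩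
    · exact ⟨huS, hvS, hRuv, fun h' => h (hd0 h'),
        hdeg.resolve_right fun h' => h h'.2.2⟩
    · exact ⟨hvS, huS, hR _ _ hRuv, fun h' => h (hc0 h'),
        (hdeg.resolve_right fun h' => h h'.2.1).symm⟩
  have hcut' : ∀ x U, x ∈ U → s ∉ U → cutSize (mergeLinks m₀ u v c d) {x} ≤
      cutSize (mergeLinks m₀ u v c d) U := by
    intro x U hx hsU
    by_cases hxw : x = w
    · subst hxw
      have h0 : cutSize (mergeLinks m₀ u v c d) {x} = 0 := by
        have := cutSize_insert_of_isolated hm₀ ∅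
        rw [insert_empty_eq] at this
        rw [cutSize_mergeLinks, this]
        simp [huw, hvw, cutSize]
      rw [h0]
      exact Nat.zero_le _
    · obtain ⟨U', hU', -, heq⟩ := exists_cutSize_splitLinks_eq (a := a) hm₀ huw hvw hdeg U
      rw [← heq, cutSize_mergeLinks_singleton (a := a) huw hvw hdeg hxw]
      exact hcut x U' ((hU' x hxw).2 hx) (by rwa [hU' s hws.symm])
  have hK' : ∑ x, ∑ y, mergeLinks m₀ u v c d x y ≤ Fintype.card K := by
    rw [sum_splitLinks] at hK
    rw [sum_mergeLinks]
    omega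
  obtain ⟨p, hp, hpair⟩ := ih (S.erase w) (Finset.erase_ssubset hwS)
    (Finset.mem_erase.2 ⟨hws.symm, hs⟩) _ hmerge hcut' hK'
  obtain ⟨p', hp', hother, hpu, hpv⟩ := exists_isRouting_splitLinks hm₀ hm₀s hm₀l huw hvw hws hdeg
    hc0 hd0 hcut hcb hda hK hp fun hus hvs => hpair u huS v hvS hus hvs hRuv
  have hpw : ∀ z ∈ S, z ≠ s → R w z → ∃ U : Finset V, w ∈ U ∧ z ∈ U ∧ s ∉ U ∧
      cutSize (splitLinks m₀ w u v a b c d) U ≤ (treesAt s p' w ∪ treesAt s p' z).card := by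
    intro z hz hzs hwz
    by_cases hzw : z = w
    · subst hzw
      refine ⟨{z}, by simp, by simp, by simp [hzs.symm], ?_⟩
      rw [Finset.union_self, hp'.card_treesAt hzs, cutSize_singleton z (hloop z)]
    · rcases hnb z (Finset.mem_erase.2 ⟨hzw, hz⟩) hwz with rfl | rfl
      exacts [hpu hzs, hpv hzs]
  refine ⟨p', hp', fun x hx y hy hxs hys hxy => ?_⟩
  by_cases hxw : x = w
  · subst hxw
    exact hpw y hy hys hxy
  by_cases hyw : y = w
  · subst hyw
    obtain ⟨U, h1, h2, h3, h4⟩ := hpw x hx hxs (hR _ _ hxy)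
    exact ⟨U, h2, h1, h3, by rwa [Finset.union_comm]⟩
  obtain ⟨U, hxU, hyU, hsU, hU⟩ := hpair x (Finset.mem_erase.2 ⟨hxw, hx⟩) y
    (Finset.mem_erase.2 ⟨hyw, hy⟩) hxs hys hxy
  obtain ⟨U', hU', -, heq⟩ := exists_cutSize_splitLinks_eq (a := a) hm₀ huw hvw hdeg U
  refine ⟨U', (hU' x hxw).2 hxU, (hU' y hyw).2 hyU, by rwa [hU' s hws.symm], ?_⟩
  rw [heq, hother x hxw, hother y hyw]
  exact hU

end Routing

/-! ### From multiplicities back to links, and the theorem. -/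

namespace Network

variable {V A : Type*}

/-- The number of links from `x` to `y`, loops and links into the source left out. -/
def linkCount [DecidableEq V] [Fintype A] (D : Network V A) (x y : V) : ℕ :=
  if x ≠ y ∧ y ≠ D.source then
    (Finset.univ.filter fun a => D.tail a = x ∧ D.head a = y).card else 0

section

variable [Fintype V] [DecidableEq V] [Fintype A] (D : Network V A)

/-- The omitted loops and links into the source enter no set avoiding the source. -/
theorem cutSize_linkCount {U : Finset V} (hs : D.source ∉ U) :
    cutSize D.linkCount U = D.inCut U := by
  rw [inCut, Finset.card_eq_sum_card_fiberwise (f := fun a => (D.tail a, D.head a))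
    (t := Finset.univ) fun _ _ => Finset.mem_coe.2 (Finset.mem_univ _), Fintype.sum_prod_type]
  unfold cutSize
  refine Finset.sum_congr rfl fun x _ => Finset.sum_congr rfl fun y _ => ?_
  rw [Finset.filter_filter]
  split_ifs with h
  · have hxy : x ≠ y ∧ y ≠ D.source :=
      ⟨fun h' => h.1 (h' ▸ h.2), fun h' => hs (h' ▸ h.2)⟩
    rw [linkCount, if_pos hxy]
    congr 1
    ext a
    simp only [Finset.mem_filter, Finset.mem_univ, true_and, Prod.mk.injEq]
    exact ⟨fun ha => ⟨by rwa [ha.1, ha.2], ha⟩, fun ha => ha.2⟩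
  · rw [eq_comm, Finset.card_eq_zero, Finset.filter_eq_empty_iff]
    rintro a - ⟨ha, ha'⟩
    obtain ⟨rfl, rfl⟩ := Prod.mk.inj ha'
    exact h ha

theorem sum_linkCount_le : ∑ x, ∑ y, D.linkCount x y ≤ Fintype.card A := by
  calc ∑ x, ∑ y, D.linkCount x y
      ≤ ∑ x, ∑ y, (Finset.univ.filter fun a => D.tail a = x ∧ D.head a = y).card := by
        refine Finset.sum_le_sum fun x _ => Finset.sum_le_sum fun y _ => ?_
        unfold linkCount
        split_ifs <;> simp
    _ = ∑ q : V × V, (Finset.univ.filter fun a => (D.tail a, D.head a) = q).card := by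
        rw [Fintype.sum_prod_type]
        simp only [Prod.mk.injEq]
    _ = Fintype.card A := by
        rw [← Finset.card_univ]
        exact (Finset.card_eq_sum_card_fiberwise fun a _ => Finset.mem_univ _).symm

variable {D}

/-- A routing of the link multiplicities is realized by a tree packing. -/
theorem exists_treePacking_of_isRouting [DecidableEq A] {k : ℕ} {p : Fin k → V → Option V}
    (hp : IsRouting D.source D.linkCount p) :
    ∃ P : D.TreePacking, ∃ h : P.size = k, ∀ i v, v ∈ P.nodes i ↔
      Fin.cast h i ∈ treesAt D.source p v := by
  classical
  have hs : ∀ x, D.linkCount x D.source = 0 := fun x => by simp [linkCount]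
  -- For each ordered pair of nodes, the trees stepping from `x` to `y` are assigned distinct
  -- parallel links; injectivity makes the trees link-disjoint.
  have hemb : ∀ x y, Nonempty ({i // p i y = some x} ↪ {a // D.tail a = x ∧ D.head a = y}) := by
    intro x y
    refine Function.Embedding.nonempty_of_card_le ?_
    rw [Fintype.card_subtype, Fintype.card_subtype, hp.card_eq, linkCount]
    split_ifs <;> simp
  obtain ⟨g⟩ : Nonempty (∀ x y,
      {i // p i y = some x} ↪ {a // D.tail a = x ∧ D.head a = y}) :=
    ⟨fun x y => (hemb x y).some⟩
  let links : Fin k → Finset A := fun i => Finset.univ.filter fun a =>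
    ∃ h : p i (D.head a) = some (D.tail a), (g (D.tail a) (D.head a) ⟨i, h⟩).1 = a
  have hlinks : ∀ i a, a ∈ links i ↔
      ∃ h : p i (D.head a) = some (D.tail a), (g (D.tail a) (D.head a) ⟨i, h⟩).1 = a :=
    fun i a => by simp [links]
  have hg : ∀ i x y (h : p i y = some x), (g x y ⟨i, h⟩).1 ∈ links i := by
    intro i x y h
    rcases hgi : g x y ⟨i, h⟩ with ⟨a, rfl, rfl⟩
    exact (hlinks i a).2 ⟨h, by rw [hgi]⟩
  have htree : ∀ i, D.IsSourceTree
      (Finset.univ.filter fun v => i ∈ treesAt D.source p v) (links i) := by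
    intro i
    refine ⟨by simp [treesAt], fun a ha => ?_, fun a ha => ?_, fun a ha => ?_, fun v hv hvs => ?_,
      fun v hv => ?_⟩
    · obtain ⟨h, -⟩ := (hlinks i a).1 ha
      simpa using hp.mem_treesAt_of_eq_some hs h
    · obtain ⟨h, -⟩ := (hlinks i a).1 ha
      simp [treesAt, h]
    · obtain ⟨h, -⟩ := (hlinks i a).1 ha
      intro hhead
      rw [hhead] at h
      exact hp.ne_some (hs _) i h
    · simp only [treesAt, Finset.mem_filter, Finset.mem_univ, true_and, hvs, false_or] at hv
      obtain ⟨x, hx⟩ := Option.ne_none_iff_exists'.1 hv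
      refine ⟨(g x v ⟨i, hx⟩).1, ⟨hg i x v hx, (g x v ⟨i, hx⟩).2.2⟩, ?_⟩
      rintro b ⟨hb, rfl⟩
      obtain ⟨h, hbg⟩ := (hlinks i b).1 hb
      obtain rfl := Option.some.inj (hx.symm.trans h)
      exact hbg.symm
    · simp only [Finset.mem_filter, Finset.mem_univ, true_and] at hv
      exact Relation.ReflTransGen.mono (fun x y hxy => ⟨(g x y ⟨i, hxy⟩).1, hg i x y hxy,
        (g x y ⟨i, hxy⟩).2⟩) _ _ (hp.reach_of_mem_treesAt hv)
  refine ⟨⟨k, _, links, htree, fun i j hij => ?_⟩, rfl, fun i v => by simp⟩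
  rw [Finset.disjoint_left]
  intro a hai haj
  obtain ⟨hi, hai⟩ := (hlinks i a).1 hai
  obtain ⟨hj, haj⟩ := (hlinks j a).1 haj
  have := (g (D.tail a) (D.head a)).injective (Subtype.ext (hai.trans haj.symm))
  exact hij (congrArg Subtype.val this)

end

end Network

theorem mainTheorem2 {V A X : Type*} [Fintype V] [DecidableEq V] [Fintype A] [DecidableEq A]
    [Fintype X] (D : Network V A) (hD : D.IsLinkMinimal)
    (T : TreeDecomposition D.topology X) (hT : T.width ≤ 2) :
    ∃ P : D.TreePacking,
      (∀ v, v ≠ D.source →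
        ((Finset.univ.filter fun i => v ∈ P.nodes i).card : ℝ) = D.maxFlow v) ∧
      (∀ u v, u ≠ D.source → v ≠ D.source → (∃ x, u ∈ T.bag x ∧ v ∈ T.bag x) →
        D.pairCut u v ≤ (Finset.univ.filter fun i => u ∈ P.nodes i ∨ v ∈ P.nodes i).card) := by
  obtain ⟨p, hp, hpair⟩ := exists_isRouting (K := Fin (Fintype.card A)) (s := D.source)
    (R := T.Share) (fun x y ⟨z, hx, hy⟩ => ⟨z, hy, hx⟩)
    (fun S hs hS => T.exists_elimination hT hs hS) Finset.univ (Finset.mem_univ _) D.linkCount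
    (fun x y h => by
      unfold Network.linkCount at h
      split_ifs at h with hxy
      · obtain ⟨a, ha⟩ := Finset.card_pos.1 (Nat.pos_of_ne_zero h)
        simp only [Finset.mem_filter, Finset.mem_univ, true_and] at ha
        refine ⟨Finset.mem_univ _, Finset.mem_univ _, T.edge_mem x y ?_, hxy.2, hxy.1⟩
        rw [Network.topology, SimpleGraph.fromRel_adj]
        exact ⟨hxy.1, Or.inl ⟨a, ha⟩⟩
      · exact absurd rfl h)
    (fun x U hx hs => by
      rw [D.cutSize_linkCount hs, D.cutSize_linkCount]
      · exact hD.inCut_singleton_le hx hs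
      · rw [Finset.mem_singleton]
        exact fun h => hs (h ▸ hx))
    (by simpa using D.sum_linkCount_le)
  obtain ⟨P, hk, hP⟩ := Network.exists_treePacking_of_isRouting hp
  obtain ⟨k, nodes, links, h1, h2⟩ := P
  dsimp only at hk hP
  subst hk
  refine ⟨⟨_, nodes, links, h1, h2⟩, fun v hv => ?_, fun u v hu hv huv => ?_⟩
  · rw [hD.maxFlow_eq_inCut_singleton hv, ← D.cutSize_linkCount (U := {v}) (by simpa using hv.symm),
      cutSize_singleton v (by simp [Network.linkCount]), ← hp.card_treesAt hv]
    congr 2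
    ext i
    simp [hP]
  · obtain ⟨U, huU, hvU, hsU, hU⟩ :=
      hpair u (Finset.mem_univ _) v (Finset.mem_univ _) hu hv huv
    rw [D.cutSize_linkCount hsU] at hU
    have hle : D.pairCut u v ≤ D.inCut U := Nat.sInf_le ⟨U, huU, hvU, hsU, rfl⟩
    refine hle.trans (hU.trans_eq ?_)
    congr 1
    ext i
    simp [hP]
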